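/- **Setting.** Let $\Omega\subset\mathbb R^d$ ($d\ge 1$) be a bounded open set with flat faces (it has finitely many outer unit normals and finite surface measure, and at almost every boundary point it is locally a half-space), $T>0$, $\Omega_T=\Omega\times(0,T)$, and let $\Gamma_T=\partial\Omega_T=(\partial\Omega\times[0,T])\cup(\Omega\times\{0,T\})$ carry surface measure and the space-time outer unit normal $\nu$. Let $f=(f_1,\dots,f_d)$ be a $C^1$ flux on an open set $D\subset\mathbb R^n$ of admissible states such that $\sum_k\xi_kf_k'(u)$ is diagonalizable over $\mathbb R$ for all $u\in D$, $\xi\in\mathbb R^d$. For $\nu=(n,\tau)$ put $\mathbf f_\nu(u)=\sum_k n_kf_k(u)+\tau u$; let $P_-(u)$ be the projection onto the eigenvectors of $\mathbf f_\nu'(u)$ with negative eigenvalues along the other eigenvectors, and $P_+=\mathrm{Id}-P_-$. Let $A=(f_1',\dots,f_d')$, let $(\cdot,\cdot)_X$ denote the $L^2$ pairing on $X$, and let $\mathcal V=W^{1,\infty}(\Omega_T)$ be the space of functions $\varphi:\Omega_T\to\mathbb R^n$ that are Lipschitz up to the boundary. Let $g\in L^1(\Gamma_T)$, and let $U$ be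 a weak solution of $U_t+\nabla\cdot f(U)=0$ in $\Omega_T$, $P_-(U^+)(\mathbf f_\nu(U^+)-g)=0$ on $\Gamma_T$ (on $t=0$ the datum $-g$ is the initial value). This means: $U$ and $f(U)$ are integrable on $\Omega_T$, $U$ has an interior trace $U^+$ on $\Gamma_T$, $U$ and $U^+$ take values in $D$ almost everywhere, $P_+(U^+)\mathbf f_\nu(U^+)$ and $P_-(U^+)g$ are integrable on $\Gamma_T$, and for all $\varphi\in\mathcal V$ $$(U,\varphi_t)_{\Omega_T}+(f(U),\nabla\varphi)_{\Omega_T}-(P_+(U^+)\mathbf f_\nu(U^+),\varphi)_{\Gamma_T}=(P_-(U^+)g,\varphi)_{\Gamma_T}.$$ **Discretization.** Let $\Omega$ be partitioned into finitely many open cells $V_i$ with flat faces, let $0=t_0<\dots<t_N=T$, $V_i^m=V_i\times[t_{m-1},t_m]$, and let $\theta\in[0,1]$. Let $U_h$ be piecewise constant with value $U_i^m\in D$ on $V_i^m$, let $U_i^0$ be the average over $V_i$ of the initial value $-g(\cdot,0)$, and let $U_h^+$ be the interior trace of $U_h$ on $\Gamma_T$. Let $F$ be a consistent, conservative numerical flux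 function. The outward numerical flux $\mathcal F_\nu(U_h)$ of $V_i^m$ is: $F(U_i^m,U_j^m,n_{ij})$ on a lateral face shared with $V_j^m$; $(1-\theta)U_i^{m-1}+\theta U_i^m$ on $V_i\times\{t_m\}$ for $1\le m\le N-1$, where $\nu=(0,1)$ (and minus the corresponding value at $t_{m-1}$ on the bottom face $V_i\times\{t_{m-1}\}$, for $m\ge2$); $P_+(U_i^m)\mathbf f_\nu(U_i^m)+P_-(U_i^m)g$ on faces contained in $\Gamma_T$ (lateral, $t=0$ and $t=T$). For piecewise Lipschitz $\varphi$ put $$N(U_h,\varphi)=\sum_{i,m}(\mathcal F_\nu(U_h),\varphi)_{\partial V_i^m}-\sum_{i,m}\big((U_h,\varphi_t)_{V_i^m}+(f(U_h),\nabla\varphi)_{V_i^m}\big).$$ Let $U_h$ be the finite volume / DG0 solution: $N(U_h,\varphi_h)=0$ for all piecewise constant $\varphi_h$. **Theorem.** Let $\psi$ on $\Omega_T$ and $\psi_\Gamma$ on $\Gamma_T$ be weights such that $J(U)=(U,\psi)_{\Omega_T}-(P_+(U^+)\mathbf f_\nu(U^+),\psi_\Gamma)_{\Gamma_T}$ and $J(U_h)$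 are defined (the integrals converge absolutely). Suppose $\varphi\in\mathcal V$ solves, almost everywhere, $$\partial_t\varphi+\tilde A^T\nabla\varphi=\psi\ \text{ in }\Omega_T,\qquad \tilde P_+^T(\varphi-\psi_\Gamma)=0\ \text{ on }\Gamma_T,$$ with $\tilde A=A(U_h)$, $\tilde P_+=P_+(U_h^+)$. Put $\varepsilon_J=J(U)-J(U_h)$ and $$\varepsilon_\Gamma^-=-\big((P_-(U^+)-P_-(U_h^+))g,\varphi\big)_{\Gamma_T},\qquad \varepsilon_\Gamma^+=-\big(P_+(U^+)\mathbf f_\nu(U^+)-P_+(U_h^+)\mathbf f_\nu(U_h^+),\varphi-\psi_\Gamma\big)_{\Gamma_T},$$ $$\varepsilon_\Omega=\big(f(U)-f(U_h)-\tilde A(U-U_h),\nabla\varphi\big)_{\Omega_T}.$$ Then, with $\eta=N(U_h,\varphi)$, for every piecewise constant $\varphi_h$, $$\varepsilon_J+\varepsilon_\Gamma^-+\varepsilon_\Gamma^++\varepsilon_\Omega=\eta=N(U_h,\varphi-\varphi_h).$$ -/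

import Mathlib

open MeasureTheory Set Filter Topology
open scoped RealInnerProductSpace ENNReal

namespace AdjointError

noncomputable section

/-- The physical space `ℝ^d`. -/
abbrev Space (d : ℕ) := EuclideanSpace ℝ (Fin d)

/-- Space-time points `(x, t)`. -/
abbrev SpaceTime (d : ℕ) := Space d × ℝ

/-- State vectors of the system (`n` conserved variables). -/
abbrev State (n : ℕ) := EuclideanSpace ℝ (Fin n)

/-! ### Geometry -/

/-- Near `x`, the set `V` is the open half-space through `x` with outer unit normal `ν`. -/
def IsFlatAt {d : ℕ} (V : Set (Space d)) (x ν : Space d) : Prop :=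
  ‖ν‖ = 1 ∧ ∃ ε > 0, ∀ y ∈ Metric.ball x ε, y ∈ V ↔ ⟪y - x, ν⟫ < 0

/-- A bounded open set with flat faces: it has finitely many outer unit normals, and off a set of
surface measure zero (edges, vertices) it lies locally on one side of its boundary. The function
`normal` is the outer unit normal on the boundary; its values elsewhere are irrelevant. The
surface measure is the `(d-1)`-dimensional Hausdorff measure in the Euclidean normalization. -/
structure Polyhedron (d : ℕ) where
  carrier : Set (Space d)
  isOpen : IsOpen carrier
  nonempty : carrier.Nonempty
  isBounded : Bornology.IsBounded carrier
  normal : Space d → Space d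
  normal_measurable : Measurable normal
  normal_finite : (Set.range normal).Finite
  surface_finite : μHE[d - 1] (frontier carrier) < ∞
  frontier_null : volume (frontier carrier) = 0
  flat : ∀ᵐ x ∂((μHE[d - 1] : Measure (Space d)).restrict (frontier carrier)),
    IsFlatAt carrier x (normal x)

/-- The space-time domain `Ω_T = Ω × (0,T)`. -/
def Polyhedron.cylinder {d : ℕ} (Ω : Polyhedron d) (T : ℝ) : Set (SpaceTime d) :=
  Ω.carrier ×ˢ Ioo 0 T

/-- Lebesgue measure on `Ω_T`. -/
def Polyhedron.interiorMeasure {d : ℕ} (Ω : Polyhedron d) (T : ℝ) : Measure (SpaceTime d) :=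
  volume.restrict (Ω.cylinder T)

/-- Surface measure on the boundary `Γ_T` of `Ω_T`, which consists of the lateral boundary
`∂Ω × [0,T]`, the bottom `Ω × {0}` and the top `Ω × {T}`. -/
def Polyhedron.boundaryMeasure {d : ℕ} (Ω : Polyhedron d) (T : ℝ) : Measure (SpaceTime d) :=
  ((μHE[d - 1] : Measure (Space d)).restrict (frontier Ω.carrier)).prod (volume.restrict (Icc 0 T))
    + (volume.restrict Ω.carrier).prod (Measure.dirac (0 : ℝ))
    + (volume.restrict Ω.carrier).prod (Measure.dirac T)

/-- The space-time outer unit normal `ν` to `Ω_T` on `Γ_T`. -/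
def Polyhedron.stNormal {d : ℕ} (Ω : Polyhedron d) (T : ℝ) (z : SpaceTime d) : SpaceTime d :=
  if z.2 = 0 then (0, -1) else if z.2 = T then (0, 1) else (Ω.normal z.1, 0)

/-- `Up` is the interior trace of `U` on `Γ_T`: at almost every boundary point `z`, the mean of
`|U - Up z|` over the part of a small ball that lies in `Ω_T` tends to zero with the radius. -/
def IsInteriorTrace {d n : ℕ} (Ω : Polyhedron d) (T : ℝ) (U Up : SpaceTime d → State n) : Prop :=
  ∀ᵐ z ∂(Ω.boundaryMeasure T),
    Tendsto (fun r : ℝ => ⨍⁻ w in Metric.ball z r ∩ Ω.cylinder T, ‖U w - Up z‖ₑ ∂volume) (𝓝[>] 0)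
      (𝓝 0)

/-- The test space `W^{1,∞}(Ω_T)`: functions that are Lipschitz up to the boundary. -/
def IsTest {d n : ℕ} (Ω : Polyhedron d) (T : ℝ) (φ : SpaceTime d → State n) : Prop :=
  ∃ K, LipschitzOnWith K φ (closure (Ω.cylinder T))

/-- The time derivative. -/
def dt {d n : ℕ} (φ : SpaceTime d → State n) (z : SpaceTime d) : State n :=
  fderiv ℝ φ z (0, 1)

/-- The spatial partial derivatives. -/
def dx {d n : ℕ} (φ : SpaceTime d → State n) (z : SpaceTime d) (k : Fin d) : State n :=
  fderiv ℝ φ z (EuclideanSpace.single k 1, 0)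

/-! ### The system and its characteristic projections -/

/-- The space-time normal flux `f_ν(u) = ∑ ν_k f_k(u) + ν_t u`. -/
def normalFlux {d n : ℕ} (f : Fin d → State n → State n) (ν : SpaceTime d) (u : State n) :
    State n :=
  ∑ k, ν.1 k • f k u + ν.2 • u

/-- The Jacobian `f_ν'(u)`. -/
def normalJacobian {d n : ℕ} (f : Fin d → State n → State n) (ν : SpaceTime d) (u : State n) :
    State n →L[ℝ] State n :=
  fderiv ℝ (normalFlux f ν) u

/-- The system `U_t + div f(U) = 0` is hyperbolic on the open set `D` of admissible states. -/
structure IsHyperbolic {d n : ℕ} (D : Set (State n)) (f : Fin d → State n → State n) : Prop where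
  isOpen : IsOpen D
  contDiffOn : ∀ k, ContDiffOn ℝ 1 (f k) D
  diagonalizable : ∀ u ∈ D, ∀ ξ : Space d,
    ⨆ μ : ℝ, Module.End.eigenspace (normalJacobian f (ξ, 0) u).toLinearMap μ = ⊤

/-- The span of the eigenvectors of `L` with negative eigenvalues. -/
def negSpace {n : ℕ} (L : State n →L[ℝ] State n) : Submodule ℝ (State n) :=
  ⨆ μ ∈ Iio (0 : ℝ), Module.End.eigenspace L.toLinearMap μ

/-- The span of the eigenvectors of `L` with nonnegative eigenvalues. -/
def nonnegSpace {n : ℕ} (L : State n →L[ℝ] State n) : Submodule ℝ (State n) :=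
  ⨆ μ ∈ Ici (0 : ℝ), Module.End.eigenspace L.toLinearMap μ

open Classical in
/-- The projection onto the eigenvectors of `L` with negative eigenvalues, along the remaining
ones. For a diagonalizable `L` the two spaces are complementary; otherwise the value is `0`. -/
def negProj {n : ℕ} (L : State n →L[ℝ] State n) : State n →L[ℝ] State n :=
  if h : IsCompl (negSpace L) (nonnegSpace L) then
    LinearMap.toContinuousLinearMap ((negSpace L).projection (nonnegSpace L) h)
  else 0

/-- `P_-(u)` for the normal direction `ν`. -/
def Pminus {d n : ℕ} (f : Fin d → State n → State n) (ν : SpaceTime d) (u : State n) :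
    State n →L[ℝ] State n :=
  negProj (normalJacobian f ν u)

/-- `P_+(u) = Id - P_-(u)` for the normal direction `ν`. -/
def Pplus {d n : ℕ} (f : Fin d → State n → State n) (ν : SpaceTime d) (u : State n) :
    State n →L[ℝ] State n :=
  ContinuousLinearMap.id ℝ (State n) - Pminus f ν u

/-- The outgoing component `P_+(u) f_ν(u)` of the normal flux. -/
def outFlux {d n : ℕ} (f : Fin d → State n → State n) (ν : SpaceTime d) (u : State n) : State n :=
  Pplus f ν u (normalFlux f ν u)

/-- The boundary flux `P_+(u) f_ν(u) + P_-(u) γ` with boundary datum `γ`. -/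
def boundaryFlux {d n : ℕ} (f : Fin d → State n → State n) (ν : SpaceTime d) (u γ : State n) :
    State n :=
  outFlux f ν u + Pminus f ν u γ

/-- Weak solutions `U`, with interior trace `Up`, of `U_t + div f(U) = 0` in `Ω_T` with
`P_-(U^+) (f_ν(U^+) - g) = 0` on `Γ_T`. The bottom `t = 0` belongs to `Γ_T`; there `f_ν(U) = -U`
and `P_- = Id`, so `-g` is the initial datum. -/
structure IsWeakSolution {d n : ℕ} (Ω : Polyhedron d) (T : ℝ) (D : Set (State n))
    (f : Fin d → State n → State n) (g U Up : SpaceTime d → State n) : Prop where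
  mem : ∀ᵐ z ∂(Ω.interiorMeasure T), U z ∈ D
  integrable : Integrable U (Ω.interiorMeasure T)
  integrable_flux : ∀ k, Integrable (fun z => f k (U z)) (Ω.interiorMeasure T)
  trace : IsInteriorTrace Ω T U Up
  trace_mem : ∀ᵐ z ∂(Ω.boundaryMeasure T), Up z ∈ D
  integrable_out : Integrable (fun z => outFlux f (Ω.stNormal T z) (Up z)) (Ω.boundaryMeasure T)
  integrable_in : Integrable (fun z => Pminus f (Ω.stNormal T z) (Up z) (g z))
    (Ω.boundaryMeasure T)
  weak : ∀ φ : SpaceTime d → State n, IsTest Ω T φ →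
    ∫ z, (⟪U z, dt φ z⟫ + ∑ k, ⟪f k (U z), dx φ z k⟫) ∂(Ω.interiorMeasure T)
      - ∫ z, ⟪outFlux f (Ω.stNormal T z) (Up z), φ z⟫ ∂(Ω.boundaryMeasure T)
    = ∫ z, ⟪Pminus f (Ω.stNormal T z) (Up z) (g z), φ z⟫ ∂(Ω.boundaryMeasure T)

/-! ### Space-time grid and discretization -/

/-- A grid of `Ω` with cells indexed by `ι`. -/
structure Mesh {d : ℕ} (Ω : Polyhedron d) (ι : Type*) where
  cell : ι → Polyhedron d
  disjoint : Pairwise fun i j => Disjoint (cell i).carrier (cell j).carrier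
  subset : ∀ i, (cell i).carrier ⊆ Ω.carrier
  cover : ⋃ i, closure (cell i).carrier = closure Ω.carrier

/-- A partition `0 = t_0 < t_1 < ⋯ < t_N = T`. -/
structure TimeGrid (T : ℝ) where
  N : ℕ
  t : ℕ → ℝ
  zero : t 0 = 0
  last : t N = T
  lt : ∀ m < N, t m < t (m + 1)

/-- A numerical flux function `F(u, v, ν)` (Riemann solver): consistent and conservative. -/
structure IsNumericalFlux {d n : ℕ} (D : Set (State n)) (f : Fin d → State n → State n)
    (F : State n → State n → Space d → State n) : Prop where
  consistent : ∀ u ∈ D, ∀ ν : Space d, ‖ν‖ = 1 → F u u ν = normalFlux f (ν, 0) u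
  conservative : ∀ u ∈ D, ∀ v ∈ D, ∀ ν : Space d, ‖ν‖ = 1 → F v u (-ν) = -F u v ν

section

variable {d n : ℕ} {Ω : Polyhedron d} {T : ℝ} {ι : Type*} [Fintype ι]

/-- The space-time flux through the top `V_i × {t_{m+1}}` of the cell `V_i × [t_m, t_{m+1}]`, in
the outer normal direction `(0,1)`: a boundary flux if the face lies in `Γ_T`, and a convex
combination of the old and the new cell value otherwise. -/
def topFlux (τ : TimeGrid T) (θ : ℝ) (f : Fin d → State n → State n) (g : SpaceTime d → State n)
    (U : ι → ℕ → State n) (i : ι) (m : ℕ) (x : Space d) : State n :=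
  if m + 1 = τ.N then boundaryFlux f (0, 1) (U i (m + 1)) (g (x, T))
  else (1 - θ) • U i m + θ • U i (m + 1)

/-- The space-time flux through the bottom `V_i × {t_m}` of the cell `V_i × [t_m, t_{m+1}]`, in
the outer normal direction `(0,-1)`. -/
def botFlux (θ : ℝ) (f : Fin d → State n → State n) (g : SpaceTime d → State n)
    (U : ι → ℕ → State n) (i : ι) (m : ℕ) (x : Space d) : State n :=
  if m = 0 then boundaryFlux f (0, -1) (U i (m + 1)) (g (x, 0))
  else -((1 - θ) • U i (m - 1) + θ • U i m)

/-- Surface measure on `A × [t_m, t_{m+1}]` for a piece `A` of a cell boundary. -/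
def lateralMeasure (τ : TimeGrid T) (m : ℕ) (A : Set (Space d)) : Measure (SpaceTime d) :=
  ((μHE[d - 1] : Measure (Space d)).restrict A).prod (volume.restrict (Icc (τ.t m) (τ.t (m + 1))))

/-- The semilinear form `N(U_h, φ)`. The discrete function `U_h` has the value `U i (m+1)` on the
cell `V_i × (t_m, t_{m+1})`, and `U i 0` are the initial cell averages. The second argument is a
piecewise function on the space-time grid, `φ i m` being its restriction to the closure of the
cell `V_i × (t_m, t_{m+1})`. -/
def semilinearForm [DecidableEq ι] (M : Mesh Ω ι) (τ : TimeGrid T) (θ : ℝ)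
    (f : Fin d → State n → State n) (F : State n → State n → Space d → State n)
    (g : SpaceTime d → State n) (U : ι → ℕ → State n) (φ : ι → ℕ → SpaceTime d → State n) : ℝ :=
  ∑ i, ∑ m ∈ Finset.range τ.N,
    ((∑ j ∈ Finset.univ.erase i,
        ∫ z, ⟪F (U i (m + 1)) (U j (m + 1)) ((M.cell i).normal z.1), φ i m z⟫
          ∂(lateralMeasure τ m (frontier (M.cell i).carrier ∩ frontier (M.cell j).carrier)))
      + (∫ z, ⟪boundaryFlux f ((M.cell i).normal z.1, 0) (U i (m + 1)) (g z), φ i m z⟫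
          ∂(lateralMeasure τ m (frontier (M.cell i).carrier ∩ frontier Ω.carrier)))
      + (∫ x in (M.cell i).carrier, ⟪topFlux τ θ f g U i m x, φ i m (x, τ.t (m + 1))⟫)
      + (∫ x in (M.cell i).carrier, ⟪botFlux θ f g U i m x, φ i m (x, τ.t m)⟫)
      - (∫ z in (M.cell i).carrier ×ˢ Ioo (τ.t m) (τ.t (m + 1)),
          (⟪U i (m + 1), dt (φ i m) z⟫ + ∑ k, ⟪f k (U i (m + 1)), dx (φ i m) z k⟫)))

/-- The DG0 (finite volume) solution: admissible cell values `U i m` such that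
`N(U_h, φ_h) = 0` for all piecewise constant `φ_h`, with initial cell averages `U i 0`. -/
structure IsDG0Solution [DecidableEq ι] (M : Mesh Ω ι) (τ : TimeGrid T) (θ : ℝ)
    (D : Set (State n)) (f : Fin d → State n → State n)
    (F : State n → State n → Space d → State n) (g : SpaceTime d → State n)
    (U : ι → ℕ → State n) : Prop where
  mem : ∀ i, ∀ m < τ.N, U i (m + 1) ∈ D
  initial : ∀ i, U i 0 = ⨍ x in (M.cell i).carrier, -g (x, 0)
  galerkin : ∀ c : ι → ℕ → State n, semilinearForm M τ θ f F g U (fun i m _ => c i m) = 0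

/-- The piecewise constant function `U_h` on `Ω_T` with cell values `U i (m+1)`. -/
def gridFunction (M : Mesh Ω ι) (τ : TimeGrid T) (U : ι → ℕ → State n) (z : SpaceTime d) :
    State n :=
  ∑ i, ∑ m ∈ Finset.range τ.N,
    ((M.cell i).carrier ×ˢ Ioo (τ.t m) (τ.t (m + 1))).indicator (fun _ => U i (m + 1)) z

end

/-! ### Target functional, adjoint problem and error terms -/

section

variable {d n : ℕ}

/-- The target functional `J(U) = (U, ψ)_{Ω_T} - (P_+(U^+) f_ν(U^+), ψ_Γ)_{Γ_T}`. -/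
def target (Ω : Polyhedron d) (T : ℝ) (f : Fin d → State n → State n)
    (ψ ψΓ U Up : SpaceTime d → State n) : ℝ :=
  ∫ z, ⟪U z, ψ z⟫ ∂(Ω.interiorMeasure T)
    - ∫ z, ⟪outFlux f (Ω.stNormal T z) (Up z), ψΓ z⟫ ∂(Ω.boundaryMeasure T)

/-- The integrals that define `J(U)` converge absolutely. -/
def TargetDefined (Ω : Polyhedron d) (T : ℝ) (f : Fin d → State n → State n)
    (ψ ψΓ U Up : SpaceTime d → State n) : Prop :=
  Integrable (fun z => ⟪U z, ψ z⟫) (Ω.interiorMeasure T) ∧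
  Integrable (fun z => ⟪outFlux f (Ω.stNormal T z) (Up z), ψΓ z⟫) (Ω.boundaryMeasure T)

/-- `φ` solves the approximate adjoint problem `∂_t φ + A(U_h)ᵀ ∇φ = ψ` in `Ω_T` and
`P_+(U_h^+)ᵀ (φ - ψ_Γ) = 0` on `Γ_T`, where `A = (f_1', …, f_d')`. -/
structure IsAdjointSolution (Ω : Polyhedron d) (T : ℝ) (f : Fin d → State n → State n)
    (ψ ψΓ Uh Uhp φ : SpaceTime d → State n) : Prop where
  test : IsTest Ω T φ
  interior : ∀ᵐ z ∂(Ω.interiorMeasure T),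
    dt φ z + ∑ k, (fderiv ℝ (f k) (Uh z)).adjoint (dx φ z k) = ψ z
  boundary : ∀ᵐ z ∂(Ω.boundaryMeasure T),
    (Pplus f (Ω.stNormal T z) (Uhp z)).adjoint (φ z - ψΓ z) = 0

/-- The inflow boundary error `-((P_-(U^+) - P_-(U_h^+)) g, φ)_{Γ_T}`. -/
def inflowError (Ω : Polyhedron d) (T : ℝ) (f : Fin d → State n → State n)
    (g Up Uhp φ : SpaceTime d → State n) : ℝ :=
  -∫ z, ⟪(Pminus f (Ω.stNormal T z) (Up z) - Pminus f (Ω.stNormal T z) (Uhp z)) (g z), φ z⟫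
    ∂(Ω.boundaryMeasure T)

/-- The outflow boundary error
`-(P_+(U^+) f_ν(U^+) - P_+(U_h^+) f_ν(U_h^+), φ - ψ_Γ)_{Γ_T}`. -/
def outflowError (Ω : Polyhedron d) (T : ℝ) (f : Fin d → State n → State n)
    (ψΓ Up Uhp φ : SpaceTime d → State n) : ℝ :=
  -∫ z, ⟪outFlux f (Ω.stNormal T z) (Up z) - outFlux f (Ω.stNormal T z) (Uhp z), φ z - ψΓ z⟫
    ∂(Ω.boundaryMeasure T)

/-- The interior linearization error `(f(U) - f(U_h) - A(U_h)(U - U_h), ∇φ)_{Ω_T}`. -/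
def linearizationError (Ω : Polyhedron d) (T : ℝ) (f : Fin d → State n → State n)
    (U Uh φ : SpaceTime d → State n) : ℝ :=
  ∫ z, (∑ k, ⟪f k (U z) - f k (Uh z) - fderiv ℝ (f k) (Uh z) (U z - Uh z), dx φ z k⟫)
    ∂(Ω.interiorMeasure T)

end

end

end AdjointError

open AdjointError

/-!
The form `N(U_h, φ)` is the defect of the discrete solution in the weak formulation. For one
function `φ` that is Lipschitz up to the boundary, the fluxes through inner faces cancel in pairs:
through lateral faces because two disjoint half-spaces with a common boundary point have opposite
normals and the numerical flux is conservative (`integral_lateral_flux_swap`), through horizontal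
faces because the sum over the time steps telescopes (`sum_topFlux_add_botFlux`). What remains are
the fluxes through the faces in `Γ_T`. These faces decompose `Γ_T` up to null sets
(`boundaryMeasure_eq_sum`), their normals are those of `Ω_T`, and the trace of `U_h` on each of them
is the adjacent cell value (`ae_trace_lateral`, `ae_trace_bottom`, `ae_trace_top`), because near
almost every point of the face the cell fills `Ω_T`. Hence (`semilinearForm_eq`)
`N(U_h, φ) = (P_+(U_h^+) f_ν(U_h^+) + P_-(U_h^+) g, φ)_{Γ_T} - (U_h, φ_t) - (f(U_h), ∇φ)`.

Subtracting the weak formulation for `U`, inserting `±ψ_Γ` on the boundary and `±A(U_h)(U - U_h)`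
in the interior, and using the adjoint equation to replace `φ_t + A(U_h)ᵀ∇φ` by `ψ` gives the error
representation. All integrals may be split because the coefficients that depend on `U_h` and on the
normals take finitely many values, `φ` is bounded and its derivative is bounded on the open set
`Ω_T`; Rademacher's theorem is not needed, as `fderiv` vanishes where `φ` is not differentiable.
The second identity is the linearity of `N(U_h, ·)` (`semilinearForm_sub_const`) together with
Galerkin orthogonality.
-/

namespace AdjointError

/-! ### Outer normals of nested and of disjoint half-spaces -/

section Normals

variable {d : ℕ} {V W : Set (Space d)} {x a b : Space d}

/-- A direction that points strictly into a locally flat set leads to a point of it that tells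
whether the direction also points into another one. -/
theorem IsFlatAt.exists_mem_and_mem_iff (hV : IsFlatAt V x a) (hW : IsFlatAt W x b) {v : Space d}
    (hv : ⟪v, a⟫ < 0) : ∃ y ∈ V, y ∈ W ↔ ⟪v, b⟫ < 0 := by
  obtain ⟨-, ε, hε, hV⟩ := hV
  obtain ⟨-, δ, hδ, hW⟩ := hW
  have hlim : Tendsto (fun s : ℝ => x + s • v) (𝓝[>] 0) (𝓝 x) := by
    have : ContinuousAt (fun s : ℝ => x + s • v) 0 := by fun_prop
    simpa [ContinuousAt] using this.tendsto.mono_left nhdsWithin_le_nhds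
  obtain ⟨s, ⟨hsε, hsδ⟩, hs⟩ := ((hlim.eventually (Metric.ball_mem_nhds x hε)).and
    (hlim.eventually (Metric.ball_mem_nhds x hδ))).and self_mem_nhdsWithin |>.exists
  have hs : 0 < s := hs
  refine ⟨x + s • v, (hV _ hsε).2 ?_, (hW _ hsδ).trans ?_⟩
  · rw [add_sub_cancel_left, inner_smul_left]
    exact mul_neg_of_pos_of_neg (by simpa using hs) hv
  · rw [add_sub_cancel_left, inner_smul_left]
    simp [mul_neg_iff, hs, hs.le]

theorem IsFlatAt.normal_eq_of_subset (hV : IsFlatAt V x a) (hW : IsFlatAt W x b) (h : V ⊆ W) :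
    a = b := by
  by_contra hab
  have ha := hV.1
  have hb := hW.1
  have hlt : ⟪a, b⟫ < 1 :=
    lt_of_le_of_ne (by simpa [ha, hb] using real_inner_le_norm a b)
      (fun h1 => hab ((inner_eq_one_iff_of_norm_eq_one (𝕜 := ℝ) ha hb).1 h1))
  have haa : ⟪a, a⟫ = (1 : ℝ) := by simp [ha]
  have hbb : ⟪b, b⟫ = (1 : ℝ) := by simp [hb]
  -- The direction `b - a` points into `V` but out of `W`.
  obtain ⟨y, hyV, hyW⟩ := hV.exists_mem_and_mem_iff hW (v := b - a) (by
    rw [inner_sub_left, haa, real_inner_comm]; linarith)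
  have := hyW.1 (h hyV)
  rw [inner_sub_left, hbb] at this
  linarith

theorem IsFlatAt.normal_eq_neg_of_disjoint (hV : IsFlatAt V x a) (hW : IsFlatAt W x b)
    (h : Disjoint V W) : b = -a := by
  by_contra hab
  have ha := hV.1
  have hb := hW.1
  have hlt : -1 < ⟪b, a⟫ :=
    lt_of_le_of_ne (by
        have := neg_le_of_abs_le (abs_real_inner_le_norm b a)
        simpa [ha, hb] using this)
      (fun h1 => hab ((inner_eq_neg_one_iff_of_norm_eq_one (𝕜 := ℝ) hb ha).1 h1.symm))
  have haa : ⟪a, a⟫ = (1 : ℝ) := by simp [ha]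
  have hbb : ⟪b, b⟫ = (1 : ℝ) := by simp [hb]
  -- The direction `-(a + b)` points into both sets.
  obtain ⟨y, hyV, hyW⟩ := hV.exists_mem_and_mem_iff hW (v := -(a + b)) (by
    rw [inner_neg_left, inner_add_left, haa]; linarith)
  refine disjoint_left.1 h hyV (hyW.2 ?_)
  rw [inner_neg_left, inner_add_left, hbb, real_inner_comm]
  linarith

/-- Two sets that are locally the same half-space coincide near the point. -/
theorem IsFlatAt.eventually_mem_iff (hV : IsFlatAt V x a) (hW : IsFlatAt W x a) :
    ∀ᶠ y in 𝓝 x, y ∈ V ↔ y ∈ W := by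
  obtain ⟨-, ε, hε, hV⟩ := hV
  obtain ⟨-, δ, hδ, hW⟩ := hW
  filter_upwards [Metric.ball_mem_nhds x hε, Metric.ball_mem_nhds x hδ] with y h1 h2
  rw [hV y h1, hW y h2]

end Normals

/-! ### Decomposition of the measures along the space-time grid -/

section Decomposition

variable {d : ℕ} {Ω : Polyhedron d} {T : ℝ} {ι : Type*}

theorem Mesh.frontier_cell_subset (M : Mesh Ω ι) (i : ι) :
    frontier (M.cell i).carrier ⊆ closure Ω.carrier :=
  frontier_subset_closure.trans (closure_mono (M.subset i))

theorem Mesh.ae_flat (M : Mesh Ω ι) (i : ι) {A : Set (Space d)}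
    (hA : A ⊆ frontier (M.cell i).carrier) :
    ∀ᵐ x ∂((μHE[d - 1] : Measure (Space d)).restrict A),
      IsFlatAt (M.cell i).carrier x ((M.cell i).normal x) :=
  ae_restrict_of_ae_restrict_of_subset hA (M.cell i).flat

theorem Polyhedron.isFiniteMeasure_restrict (P : Polyhedron d) {A : Set (Space d)}
    (hA : A ⊆ frontier P.carrier) :
    IsFiniteMeasure ((μHE[d - 1] : Measure (Space d)).restrict A) :=
  ⟨by simpa using (measure_mono hA).trans_lt P.surface_finite⟩

theorem Polyhedron.volume_carrier_lt_top (P : Polyhedron d) : volume P.carrier < ∞ :=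
  P.isBounded.measure_lt_top

theorem Mesh.measurableSet_inter (M : Mesh Ω ι) (i : ι) (P : Polyhedron d) :
    MeasurableSet (frontier (M.cell i).carrier ∩ frontier P.carrier) :=
  isClosed_frontier.measurableSet.inter isClosed_frontier.measurableSet

/-- The normals of a face shared by two cells are opposite. -/
theorem Mesh.ae_normal_eq_neg (M : Mesh Ω ι) {i j : ι} (hij : i ≠ j) :
    ∀ᵐ x ∂((μHE[d - 1] : Measure (Space d)).restrict
      (frontier (M.cell i).carrier ∩ frontier (M.cell j).carrier)),
      ‖(M.cell i).normal x‖ = 1 ∧ (M.cell j).normal x = -(M.cell i).normal x := by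
  filter_upwards [M.ae_flat i inter_subset_left, M.ae_flat j inter_subset_right] with x hi hj
  exact ⟨hi.1, hi.normal_eq_neg_of_disjoint hj (M.disjoint hij)⟩

/-- On a boundary face, a cell has the normal of the domain and fills the domain locally. -/
theorem Mesh.ae_boundary_face (M : Mesh Ω ι) (i : ι) :
    ∀ᵐ x ∂((μHE[d - 1] : Measure (Space d)).restrict
      (frontier (M.cell i).carrier ∩ frontier Ω.carrier)),
      (M.cell i).normal x = Ω.normal x ∧
        ∀ᶠ y in 𝓝 x, y ∈ (M.cell i).carrier ↔ y ∈ Ω.carrier := by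
  filter_upwards [M.ae_flat i inter_subset_left,
    ae_restrict_of_ae_restrict_of_subset inter_subset_right Ω.flat] with x hi hΩ
  have h := hi.normal_eq_of_subset hΩ (M.subset i)
  rw [← h] at hΩ
  exact ⟨h, hi.eventually_mem_iff hΩ⟩

/-- Two cells meet on the boundary only in a set of surface measure zero: otherwise they would
fill the same half-space locally. -/
theorem Mesh.aedisjoint_boundary (M : Mesh Ω ι) {i j : ι} (hij : i ≠ j) :
    AEDisjoint (μHE[d - 1] : Measure (Space d))
      (frontier (M.cell i).carrier ∩ frontier Ω.carrier)
      (frontier (M.cell j).carrier ∩ frontier Ω.carrier) := by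
  have key : ∀ᵐ x ∂((μHE[d - 1] : Measure (Space d)).restrict
      ((frontier (M.cell i).carrier ∩ frontier Ω.carrier) ∩
        (frontier (M.cell j).carrier ∩ frontier Ω.carrier))), False := by
    filter_upwards [ae_restrict_of_ae_restrict_of_subset inter_subset_left (M.ae_boundary_face i),
      ae_restrict_of_ae_restrict_of_subset inter_subset_right (M.ae_boundary_face j),
      ae_restrict_mem ((M.measurableSet_inter i Ω).inter (M.measurableSet_inter j Ω))]
      with x hi hj hx
    have hcl : x ∈ closure (M.cell i).carrier := frontier_subset_closure hx.1.1
    obtain ⟨y, hyi, h1, h2⟩ :=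
      ((mem_closure_iff_frequently.1 hcl).and_eventually (hi.2.and hj.2)).exists
    exact disjoint_left.1 (M.disjoint hij) hyi (h2.2 (h1.1 hyi))
  rw [AEDisjoint]
  simpa [ae_iff] using key

theorem Mesh.frontier_eq_iUnion (M : Mesh Ω ι) :
    frontier Ω.carrier = ⋃ i, frontier (M.cell i).carrier ∩ frontier Ω.carrier := by
  refine Subset.antisymm (fun x hx => ?_) (iUnion_subset fun i => inter_subset_right)
  have hcl : x ∈ ⋃ i, closure (M.cell i).carrier := M.cover ▸ frontier_subset_closure hx
  obtain ⟨i, hi⟩ := mem_iUnion.1 hcl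
  refine mem_iUnion.2 ⟨i, ⟨?_, hx⟩⟩
  rw [(M.cell i).isOpen.frontier_eq]
  rw [Ω.isOpen.frontier_eq] at hx
  exact ⟨hi, fun h => hx.2 (M.subset i h)⟩

theorem Mesh.restrict_frontier [Fintype ι] (M : Mesh Ω ι) :
    (μHE[d - 1] : Measure (Space d)).restrict (frontier Ω.carrier) =
      ∑ i, (μHE[d - 1] : Measure (Space d)).restrict
        (frontier (M.cell i).carrier ∩ frontier Ω.carrier) := by
  conv_lhs => rw [M.frontier_eq_iUnion]
  rw [Measure.restrict_iUnion_ae (fun i j hij => M.aedisjoint_boundary hij)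
    (fun i => (M.measurableSet_inter i Ω).nullMeasurableSet), Measure.sum_fintype]

theorem Mesh.restrict_carrier [Fintype ι] (M : Mesh Ω ι) :
    (volume : Measure (Space d)).restrict Ω.carrier =
      ∑ i, (volume : Measure (Space d)).restrict (M.cell i).carrier := by
  have h : (⋃ i, (M.cell i).carrier : Set (Space d)) =ᵐ[volume] Ω.carrier := by
    refine (LE.le.eventuallyLE (iUnion_subset M.subset)).antisymm ?_
    have hnull : ∀ᵐ x : Space d, ∀ i, x ∉ frontier (M.cell i).carrier :=
      ae_all_iff.2 fun i => measure_eq_zero_iff_ae_notMem.1 (M.cell i).frontier_null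
    filter_upwards [hnull] with x hx hxΩ
    have hcl : x ∈ ⋃ i, closure (M.cell i).carrier := M.cover ▸ subset_closure hxΩ
    obtain ⟨i, hi⟩ := mem_iUnion.1 hcl
    refine mem_iUnion.2 ⟨i, by_contra fun hxi => hx i ?_⟩
    rw [(M.cell i).isOpen.frontier_eq]
    exact ⟨hi, hxi⟩
  rw [← Measure.restrict_congr_set h, Measure.restrict_iUnion M.disjoint
    (fun i => (M.cell i).isOpen.measurableSet), Measure.sum_fintype]

theorem TimeGrid.mono (τ : TimeGrid T) {a b : ℕ} (hab : a ≤ b) (hb : b ≤ τ.N) :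
    τ.t a ≤ τ.t b := by
  induction b, hab using Nat.le_induction with
  | base => exact le_rfl
  | succ k _ ih => exact (ih (by omega)).trans (τ.lt k (by omega)).le

theorem TimeGrid.nonneg (τ : TimeGrid T) {m : ℕ} (hm : m ≤ τ.N) : 0 ≤ τ.t m :=
  τ.zero.symm.trans_le (τ.mono (Nat.zero_le m) hm)

theorem TimeGrid.le_last (τ : TimeGrid T) {m : ℕ} (hm : m ≤ τ.N) : τ.t m ≤ T :=
  (τ.mono hm le_rfl).trans_eq τ.last

theorem TimeGrid.pos (τ : TimeGrid T) (hT : 0 < T) : 0 < τ.N := by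
  refine Nat.pos_of_ne_zero fun h => hT.ne ?_
  exact τ.zero.symm.trans (h ▸ τ.last)

theorem TimeGrid.Ioo_subset (τ : TimeGrid T) {m : ℕ} (hm : m < τ.N) :
    Ioo (τ.t m) (τ.t (m + 1)) ⊆ Ioo 0 T :=
  Ioo_subset_Ioo (τ.nonneg hm.le) (τ.le_last hm)

theorem TimeGrid.disjoint_Ioo (τ : TimeGrid T) {m k : ℕ} (hm : m < τ.N) (hk : k < τ.N)
    (hmk : m ≠ k) : Disjoint (Ioo (τ.t m) (τ.t (m + 1))) (Ioo (τ.t k) (τ.t (k + 1))) := by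
  refine disjoint_left.2 fun s h1 h2 => ?_
  rcases lt_or_gt_of_ne hmk with h | h
  · linarith [τ.mono (Nat.succ_le_of_lt h) hk.le, h1.2, h2.1]
  · linarith [τ.mono (Nat.succ_le_of_lt h) hm.le, h2.2, h1.1]

theorem TimeGrid.restrict_Icc (τ : TimeGrid T) :
    (volume : Measure ℝ).restrict (Icc 0 T) =
      ∑ m ∈ Finset.range τ.N, (volume : Measure ℝ).restrict (Icc (τ.t m) (τ.t (m + 1))) := by
  have key : ∀ k ≤ τ.N, (volume : Measure ℝ).restrict (Ioc 0 (τ.t k)) =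
      ∑ m ∈ Finset.range k, (volume : Measure ℝ).restrict (Icc (τ.t m) (τ.t (m + 1))) := by
    intro k
    induction k with
    | zero => simp [τ.zero]
    | succ k ih =>
      intro hk
      have hd : Disjoint (Ioc 0 (τ.t k)) (Ioc (τ.t k) (τ.t (k + 1))) :=
        disjoint_left.2 fun s h1 h2 => h1.2.not_gt h2.1
      rw [Finset.sum_range_succ, ← ih (by omega),
        ← Ioc_union_Ioc_eq_Ioc (τ.nonneg (by omega)) (τ.lt k hk).le,
        Measure.restrict_union hd measurableSet_Ioc, Measure.restrict_congr_set
          (Ioc_ae_eq_Icc (a := τ.t k) (b := τ.t (k + 1)))]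
  rw [← key _ le_rfl, τ.last, Measure.restrict_congr_set Ioc_ae_eq_Icc]

theorem sum_prod_sum_range {α β : Type*} [MeasurableSpace α] [MeasurableSpace β] [Fintype ι]
    (μ : ι → Measure α) (ν : ℕ → Measure β) [∀ m, SFinite (ν m)] (N : ℕ) :
    (∑ i, μ i).prod (∑ m ∈ Finset.range N, ν m) =
      ∑ i, ∑ m ∈ Finset.range N, (μ i).prod (ν m) := by
  simp_rw [Finset.sum_range]
  rw [← Measure.sum_fintype, ← Measure.sum_fintype, Measure.prod_sum, Measure.sum_fintype,
    Fintype.sum_prod_type]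

theorem sum_prod_measure {α β : Type*} [MeasurableSpace α] [MeasurableSpace β] [Fintype ι]
    (μ : ι → Measure α) (ν : Measure β) [SFinite ν] :
    (∑ i, μ i).prod ν = ∑ i, (μ i).prod ν := by
  simpa using sum_prod_sum_range μ (fun _ => ν) 1

theorem interiorMeasure_eq_sum [Fintype ι] (M : Mesh Ω ι) (τ : TimeGrid T) :
    Ω.interiorMeasure T = ∑ i, ∑ m ∈ Finset.range τ.N,
      volume.restrict ((M.cell i).carrier ×ˢ Ioo (τ.t m) (τ.t (m + 1))) := by
  have h (A : Set (Space d)) (a b : ℝ) :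
      (volume : Measure (SpaceTime d)).restrict (A ×ˢ Ioo a b) =
        (volume.restrict A).prod (volume.restrict (Icc a b)) := by
    rw [Measure.volume_eq_prod, ← Measure.prod_restrict, Measure.restrict_congr_set Ioo_ae_eq_Icc]
  simp_rw [Polyhedron.interiorMeasure, Polyhedron.cylinder, h]
  rw [M.restrict_carrier, τ.restrict_Icc, sum_prod_sum_range]

/-- Lebesgue measure on the horizontal slice `A × {s}`. -/
noncomputable def sliceMeasure (A : Set (Space d)) (s : ℝ) : Measure (SpaceTime d) :=
  (volume.restrict A).prod (Measure.dirac s)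

/-- Surface measure on the boundary of the cylinder, split along the faces of the grid. -/
theorem boundaryMeasure_eq_sum [Fintype ι] (M : Mesh Ω ι) (τ : TimeGrid T) :
    Ω.boundaryMeasure T =
      (∑ i, ∑ m ∈ Finset.range τ.N,
        lateralMeasure τ m (frontier (M.cell i).carrier ∩ frontier Ω.carrier))
      + (∑ i, sliceMeasure (M.cell i).carrier 0) + ∑ i, sliceMeasure (M.cell i).carrier T := by
  rw [Polyhedron.boundaryMeasure, M.restrict_frontier, τ.restrict_Icc, sum_prod_sum_range,
    M.restrict_carrier, sum_prod_measure, sum_prod_measure]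
  rfl

theorem lateralMeasure_le_boundaryMeasure (τ : TimeGrid T) {m : ℕ} (hm : m < τ.N)
    {A : Set (Space d)} (hA : A ⊆ frontier Ω.carrier) :
    lateralMeasure τ m A ≤ Ω.boundaryMeasure T := by
  refine le_trans (Measure.prod_mono (Measure.restrict_mono hA le_rfl) (Measure.restrict_mono
    (Icc_subset_Icc (τ.nonneg hm.le) (τ.le_last hm)) le_rfl)) ?_
  rw [Polyhedron.boundaryMeasure, add_assoc]
  exact Measure.le_add_right le_rfl

theorem Mesh.sliceMeasure_zero_le (M : Mesh Ω ι) (i : ι) (T : ℝ) :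
    sliceMeasure (M.cell i).carrier 0 ≤ Ω.boundaryMeasure T := by
  refine le_trans (Measure.prod_mono (Measure.restrict_mono (M.subset i) le_rfl) le_rfl) ?_
  exact Measure.le_add_right (Measure.le_add_left le_rfl)

theorem Mesh.sliceMeasure_last_le (M : Mesh Ω ι) (i : ι) (T : ℝ) :
    sliceMeasure (M.cell i).carrier T ≤ Ω.boundaryMeasure T := by
  refine le_trans (Measure.prod_mono (Measure.restrict_mono (M.subset i) le_rfl) le_rfl) ?_
  exact Measure.le_add_left le_rfl

theorem ae_lateralMeasure_of_ae_fst (τ : TimeGrid T) (m : ℕ) {A : Set (Space d)}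
    {p : Space d → Prop} (h : ∀ᵐ x ∂((μHE[d - 1] : Measure (Space d)).restrict A), p x) :
    ∀ᵐ z ∂(lateralMeasure τ m A), p z.1 :=
  Measure.quasiMeasurePreserving_fst.ae h

/-- Almost every point of a lateral face has its time coordinate inside the time step. -/
theorem ae_lateralMeasure_snd_mem (τ : TimeGrid T) (m : ℕ) (A : Set (Space d)) :
    ∀ᵐ z ∂(lateralMeasure τ m A), z.2 ∈ Ioo (τ.t m) (τ.t (m + 1)) := by
  refine Measure.quasiMeasurePreserving_snd.ae ?_
  rw [← Measure.restrict_congr_set Ioo_ae_eq_Icc]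
  exact ae_restrict_mem measurableSet_Ioo

theorem sliceMeasure_eq_map (A : Set (Space d)) (s : ℝ) :
    sliceMeasure A s = (volume.restrict A).map fun x => (x, s) :=
  Measure.prod_dirac s

theorem ae_sliceMeasure {A : Set (Space d)} (hA : MeasurableSet A) (s : ℝ) :
    ∀ᵐ z ∂(sliceMeasure A s), z.1 ∈ A ∧ z.2 = s := by
  rw [sliceMeasure_eq_map, (measurableEmbedding_prod_mk_right s).ae_map_iff]
  filter_upwards [ae_restrict_mem hA] with x hx using ⟨hx, rfl⟩

theorem integral_sliceMeasure {E : Type*} [NormedAddCommGroup E] [NormedSpace ℝ E]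
    (A : Set (Space d)) (s : ℝ) (G : SpaceTime d → E) :
    ∫ z, G z ∂(sliceMeasure A s) = ∫ x in A, G (x, s) := by
  rw [sliceMeasure_eq_map, (measurableEmbedding_prod_mk_right s).integral_map]

end Decomposition

/-! ### The interior trace of a piecewise constant function -/

section Trace

variable {d n : ℕ} {Ω : Polyhedron d} {T : ℝ} {ι : Type*}

theorem Polyhedron.isOpen_cylinder (Ω : Polyhedron d) (T : ℝ) : IsOpen (Ω.cylinder T) :=
  Ω.isOpen.prod isOpen_Ioo

theorem Polyhedron.closure_cylinder (Ω : Polyhedron d) (hT : 0 < T) :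
    closure (Ω.cylinder T) = closure Ω.carrier ×ˢ Icc 0 T := by
  rw [Polyhedron.cylinder, closure_prod_eq, closure_Ioo hT.ne]

/-- The trace of a function that is locally constant on `Ω_T` near a boundary point is this
constant. -/
theorem trace_eq_of_eventually_eq {U : SpaceTime d → State n} {z : SpaceTime d} {c u : State n}
    (hz : z ∈ closure (Ω.cylinder T))
    (hc : ∀ᶠ w in 𝓝 z, w ∈ Ω.cylinder T → U w = c)
    (hu : Tendsto (fun r : ℝ => ⨍⁻ w in Metric.ball z r ∩ Ω.cylinder T, ‖U w - u‖ₑ ∂volume)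
      (𝓝[>] 0) (𝓝 0)) :
    u = c := by
  obtain ⟨ε, hε, hball⟩ := Metric.eventually_nhds_iff_ball.1 hc
  have hev : (fun r : ℝ => ⨍⁻ w in Metric.ball z r ∩ Ω.cylinder T, ‖U w - u‖ₑ ∂volume)
      =ᶠ[𝓝[>] 0] fun _ => ‖c - u‖ₑ := by
    filter_upwards [Ioo_mem_nhdsGT hε] with r hr
    have hopen : IsOpen (Metric.ball z r ∩ Ω.cylinder T) :=
      Metric.isOpen_ball.inter (Ω.isOpen_cylinder T)
    have hne : (Metric.ball z r ∩ Ω.cylinder T).Nonempty :=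
      mem_closure_iff_nhds.1 hz _ (Metric.ball_mem_nhds z hr.1)
    have hfin : volume (Metric.ball z r ∩ Ω.cylinder T) ≠ ∞ :=
      ((measure_mono inter_subset_left).trans_lt measure_ball_lt_top).ne
    rw [setLAverage_congr_fun hopen.measurableSet (g := fun _ => ‖c - u‖ₑ)
      (fun w hw => by rw [hball w (Metric.ball_subset_ball hr.2.le hw.1) hw.2]),
      setLAverage_const (hopen.measure_pos volume hne).ne' hfin]
  have h0 : ‖c - u‖ₑ = 0 := tendsto_nhds_unique tendsto_const_nhds (hu.congr' hev)
  exact (sub_eq_zero.1 (enorm_eq_zero.1 h0)).symm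

theorem gridFunction_eq [Fintype ι] (M : Mesh Ω ι) (τ : TimeGrid T) (V : ι → ℕ → State n) {i : ι}
    {m : ℕ} (hm : m < τ.N) {z : SpaceTime d} (hx : z.1 ∈ (M.cell i).carrier)
    (ht : z.2 ∈ Ioo (τ.t m) (τ.t (m + 1))) :
    gridFunction M τ V z = V i (m + 1) := by
  rw [gridFunction, Finset.sum_eq_single i, Finset.sum_eq_single m]
  · exact indicator_of_mem (mk_mem_prod hx ht) _
  · intro k hk hkm
    exact indicator_of_notMem (fun h => disjoint_left.1
      (τ.disjoint_Ioo (Finset.mem_range.1 hk) hm hkm) h.2 ht) _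
  · exact fun h => absurd (Finset.mem_range.2 hm) h
  · intro j _ hji
    exact Finset.sum_eq_zero fun k _ => indicator_of_notMem
      (fun h => disjoint_left.1 (M.disjoint hji) h.1 hx) _
  · exact fun h => absurd (Finset.mem_univ i) h

variable [Fintype ι] {M : Mesh Ω ι} {τ : TimeGrid T} {V : ι → ℕ → State n}
  {Up : SpaceTime d → State n}

theorem ae_trace_lateral (hUp : IsInteriorTrace Ω T (gridFunction M τ V) Up) (i : ι) {m : ℕ}
    (hm : m < τ.N) :
    ∀ᵐ z ∂(lateralMeasure τ m (frontier (M.cell i).carrier ∩ frontier Ω.carrier)),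
      Ω.stNormal T z = ((M.cell i).normal z.1, 0) ∧ Up z = V i (m + 1) := by
  have hT : 0 < T := ((τ.nonneg hm.le).trans_lt (τ.lt m hm)).trans_le (τ.le_last hm)
  filter_upwards [ae_lateralMeasure_snd_mem τ m _,
    ae_lateralMeasure_of_ae_fst τ m (M.ae_boundary_face i),
    ae_lateralMeasure_of_ae_fst τ m (ae_restrict_mem (M.measurableSet_inter i Ω)),
    ae_mono (lateralMeasure_le_boundaryMeasure τ hm inter_subset_right) hUp]
    with z ht hface hmem htr
  have ht' := τ.Ioo_subset hm ht
  refine ⟨?_, trace_eq_of_eventually_eq (T := T) (Ω := Ω) ?_ ?_ htr⟩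
  · rw [Polyhedron.stNormal, if_neg ht'.1.ne', if_neg ht'.2.ne, hface.1]
  · rw [Ω.closure_cylinder hT]
    exact ⟨frontier_subset_closure hmem.2, ht'.1.le, ht'.2.le⟩
  · filter_upwards [continuous_fst.continuousAt.eventually hface.2,
      continuous_snd.continuousAt.eventually (isOpen_Ioo.mem_nhds ht)] with w hw1 hw2 hw
    exact gridFunction_eq M τ V hm (hw1.2 hw.1) hw2

theorem ae_trace_bottom (hT : 0 < T)
    (hUp : IsInteriorTrace Ω T (gridFunction M τ V) Up) (i : ι) :
    ∀ᵐ z ∂(sliceMeasure (M.cell i).carrier 0), Ω.stNormal T z = (0, -1) ∧ Up z = V i 1 := by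
  have hN := τ.pos hT
  filter_upwards [ae_sliceMeasure (M.cell i).isOpen.measurableSet 0,
    ae_mono (M.sliceMeasure_zero_le i T) hUp] with z hz htr
  refine ⟨by rw [Polyhedron.stNormal, if_pos hz.2], trace_eq_of_eventually_eq (T := T) ?_ ?_ htr⟩
  · rw [Ω.closure_cylinder hT]
    exact ⟨subset_closure (M.subset i hz.1), hz.2.ge, hz.2.trans_le hT.le⟩
  · filter_upwards [continuous_fst.continuousAt.eventually
      ((M.cell i).isOpen.mem_nhds hz.1), continuous_snd.continuousAt.eventually
      (isOpen_Iio.mem_nhds (show z.2 ∈ Iio (τ.t 1) by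
        rw [hz.2]; exact τ.zero.symm.trans_lt (τ.lt 0 hN)))] with w hw1 hw2 hw
    exact gridFunction_eq M τ V hN hw1 ⟨τ.zero.trans_lt hw.2.1, hw2⟩

theorem ae_trace_top (hT : 0 < T)
    (hUp : IsInteriorTrace Ω T (gridFunction M τ V) Up) (i : ι) :
    ∀ᵐ z ∂(sliceMeasure (M.cell i).carrier T), Ω.stNormal T z = (0, 1) ∧ Up z = V i τ.N := by
  obtain ⟨m, hm⟩ : ∃ m, τ.N = m + 1 := Nat.exists_eq_succ_of_ne_zero (τ.pos hT).ne'
  have hmN : m < τ.N := by omega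
  have hlast : τ.t (m + 1) = T := hm ▸ τ.last
  rw [hm]
  filter_upwards [ae_sliceMeasure (M.cell i).isOpen.measurableSet T,
    ae_mono (M.sliceMeasure_last_le i T) hUp] with z hz htr
  refine ⟨?_, trace_eq_of_eventually_eq (T := T) (Ω := Ω) ?_ ?_ htr⟩
  · rw [Polyhedron.stNormal, if_neg (hz.2.trans_ne hT.ne'), if_pos hz.2]
  · rw [Ω.closure_cylinder hT]
    exact ⟨subset_closure (M.subset i hz.1), hT.le.trans_eq hz.2.symm, hz.2.le⟩
  · filter_upwards [continuous_fst.continuousAt.eventually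
      ((M.cell i).isOpen.mem_nhds hz.1), continuous_snd.continuousAt.eventually
      (isOpen_Ioi.mem_nhds (show z.2 ∈ Ioi (τ.t m) by
        simpa [hz.2] using (τ.lt m hmN).trans_eq hlast))] with w hw1 hw2 hw
    exact gridFunction_eq M τ V hmN hw1 ⟨hw2, hw.2.2.trans_eq hlast.symm⟩

end Trace

/-! ### Integrability -/

section Integrability

variable {d n : ℕ} {Ω : Polyhedron d} {T : ℝ} {ι : Type*} {μ : Measure (SpaceTime d)}

theorem IsTest.integrable_inner {φ : SpaceTime d → State n} (hφ : IsTest Ω T φ)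
    (hμ : ∀ᵐ z ∂μ, z ∈ closure (Ω.cylinder T)) {h : SpaceTime d → State n} (hh : Integrable h μ) :
    Integrable (fun z => ⟪h z, φ z⟫) μ := by
  obtain ⟨K, hK⟩ := hφ
  have hcpt : IsCompact (closure (Ω.cylinder T)) :=
    (Ω.isBounded.prod (Metric.isBounded_Ioo 0 T)).isCompact_closure
  obtain ⟨C, hC⟩ := hcpt.exists_bound_of_continuousOn hK.continuousOn
  have hmeas : AEStronglyMeasurable φ μ := by
    rw [← Measure.restrict_eq_self_of_ae_mem hμ]
    exact hK.continuousOn.aestronglyMeasurable isClosed_closure.measurableSet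
  refine (hh.norm.mul_const C).mono' (hh.aestronglyMeasurable.inner hmeas) ?_
  filter_upwards [hμ] with z hz
  exact (norm_inner_le_norm _ _).trans (by gcongr; exact hC z hz)

/-- The Lipschitz constant bounds `fderiv` at every point of the open set `Ω_T`, also where `φ` is
not differentiable and `fderiv` is zero by convention. -/
theorem IsTest.integrable_inner_fderiv {φ : SpaceTime d → State n} (hφ : IsTest Ω T φ)
    {h : SpaceTime d → State n} (hh : Integrable h (Ω.interiorMeasure T)) (v : SpaceTime d) :
    Integrable (fun z => ⟪h z, fderiv ℝ φ z v⟫) (Ω.interiorMeasure T) := by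
  obtain ⟨K, hK⟩ := hφ
  have hmeas : Measurable fun z => fderiv ℝ φ z v := measurable_fderiv_apply_const ℝ φ v
  refine (hh.norm.mul_const (K * ‖v‖)).mono'
    (hh.aestronglyMeasurable.inner hmeas.aestronglyMeasurable) ?_
  filter_upwards [ae_restrict_mem (Ω.isOpen_cylinder T).measurableSet] with z hz
  refine (norm_inner_le_norm _ _).trans ?_
  gcongr
  refine (fderiv ℝ φ z).le_of_opNorm_le ?_ v
  exact norm_fderiv_le_of_lipschitzOn ℝ
    (mem_of_superset ((Ω.isOpen_cylinder T).mem_nhds hz) subset_closure) hK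

/-- Any function of the normal, measurable or not, is a simple function, because the normal takes
only finitely many values. -/
theorem Polyhedron.exists_simpleFunc_normal {E : Type*} (P : Polyhedron d) (G : Space d → E) :
    ∃ S : SimpleFunc (SpaceTime d) E, ∀ z, S z = G (P.normal z.1) := by
  let S : SimpleFunc (Space d) (Space d) :=
    ⟨P.normal, fun x => P.normal_measurable (measurableSet_singleton x), P.normal_finite⟩
  exact ⟨(S.comp Prod.fst measurable_fst).map G, fun z => rfl⟩

theorem Polyhedron.integrable_comp_normal [IsFiniteMeasure μ] (P : Polyhedron d)
    (G : Space d → State n) : Integrable (fun z => G (P.normal z.1)) μ := by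
  obtain ⟨S, hS⟩ := P.exists_simpleFunc_normal G
  simp_rw [← hS]
  exact S.integrable_of_isFiniteMeasure

theorem Polyhedron.integrable_normal_apply (P : Polyhedron d)
    (L : Space d → State n →L[ℝ] State n) {h : SpaceTime d → State n} (hh : Integrable h μ) :
    Integrable (fun z => L (P.normal z.1) (h z)) μ := by
  obtain ⟨S, hS⟩ := P.exists_simpleFunc_normal L
  simp_rw [← hS]
  obtain ⟨C, hC⟩ := S.exists_forall_norm_le
  refine (hh.norm.const_mul C).mono'
    ((ContinuousLinearMap.id ℝ (State n →L[ℝ] State n)).aestronglyMeasurable_comp₂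
      S.stronglyMeasurable.aestronglyMeasurable hh.aestronglyMeasurable) ?_
  exact ae_of_all _ fun z => (S z).le_of_opNorm_le (hC z) (h z)

theorem isFiniteMeasure_lateralMeasure (τ : TimeGrid T) (m : ℕ) (P : Polyhedron d)
    {A : Set (Space d)} (hA : A ⊆ frontier P.carrier) : IsFiniteMeasure (lateralMeasure τ m A) := by
  have := P.isFiniteMeasure_restrict hA
  exact inferInstanceAs (IsFiniteMeasure (Measure.prod _ _))

theorem isFiniteMeasure_sliceMeasure (P : Polyhedron d) (s : ℝ) :
    IsFiniteMeasure (sliceMeasure P.carrier s) := by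
  have : IsFiniteMeasure ((volume : Measure (Space d)).restrict P.carrier) :=
    ⟨by simpa using P.volume_carrier_lt_top⟩
  exact inferInstanceAs (IsFiniteMeasure (Measure.prod _ _))

theorem isFiniteMeasure_boxMeasure (P : Polyhedron d) (a b : ℝ) :
    IsFiniteMeasure ((volume : Measure (SpaceTime d)).restrict (P.carrier ×ˢ Ioo a b)) :=
  ⟨by simpa using (P.isBounded.prod (Metric.isBounded_Ioo a b)).measure_lt_top⟩

theorem ae_lateralMeasure_mem_closure (τ : TimeGrid T) {m : ℕ} (hm : m < τ.N) {A : Set (Space d)}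
    (hA : MeasurableSet A) (hAΩ : A ⊆ closure Ω.carrier) :
    ∀ᵐ z ∂(lateralMeasure τ m A), z ∈ closure (Ω.cylinder T) := by
  have hT : 0 < T := ((τ.nonneg hm.le).trans_lt (τ.lt m hm)).trans_le (τ.le_last hm)
  filter_upwards [ae_lateralMeasure_snd_mem τ m A,
    ae_lateralMeasure_of_ae_fst τ m (ae_restrict_mem hA)] with z hz hx
  rw [Ω.closure_cylinder hT]
  exact ⟨hAΩ hx, Ioo_subset_Icc_self (τ.Ioo_subset hm hz)⟩

theorem Mesh.ae_sliceMeasure_mem_closure (M : Mesh Ω ι) (i : ι) (hT : 0 < T) {s : ℝ}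
    (hs : s ∈ Icc 0 T) :
    ∀ᵐ z ∂(sliceMeasure (M.cell i).carrier s), z ∈ closure (Ω.cylinder T) := by
  filter_upwards [ae_sliceMeasure (M.cell i).isOpen.measurableSet s] with z hz
  rw [Ω.closure_cylinder hT]
  exact ⟨subset_closure (M.subset i hz.1), hz.2.symm ▸ hs⟩

theorem Mesh.ae_boundaryMeasure_mem_closure [Fintype ι] (M : Mesh Ω ι) (τ : TimeGrid T)
    (hT : 0 < T) : ∀ᵐ z ∂(Ω.boundaryMeasure T), z ∈ closure (Ω.cylinder T) := by
  rw [boundaryMeasure_eq_sum M τ, ae_add_measure_iff, ae_add_measure_iff]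
  simp_rw [ae_finsetSum_measure_iff]
  refine ⟨⟨fun i _ m hm => ?_, fun i _ => ?_⟩, fun i _ => ?_⟩
  · exact ae_lateralMeasure_mem_closure τ (Finset.mem_range.1 hm) (M.measurableSet_inter i Ω)
      (inter_subset_left.trans (M.frontier_cell_subset i))
  · exact M.ae_sliceMeasure_mem_closure i hT ⟨le_rfl, hT.le⟩
  · exact M.ae_sliceMeasure_mem_closure i hT ⟨hT.le, le_rfl⟩

theorem integrable_sliceMeasure_iff {E : Type*} [NormedAddCommGroup E] {A : Set (Space d)} {s : ℝ}
    {G : SpaceTime d → E} :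
    Integrable G (sliceMeasure A s) ↔ IntegrableOn (fun x => G (x, s)) A := by
  rw [sliceMeasure_eq_map, (measurableEmbedding_prod_mk_right s).integrable_map_iff]
  rfl

theorem integrable_boundaryFlux_normal (P : Polyhedron d) [IsFiniteMeasure μ]
    {g : SpaceTime d → State n} (hg : Integrable g μ) (f : Fin d → State n → State n)
    (u : State n) : Integrable (fun z => boundaryFlux f (P.normal z.1, 0) u (g z)) μ :=
  (P.integrable_comp_normal fun ν => outFlux f (ν, 0) u).add
    (P.integrable_normal_apply (fun ν => Pminus f (ν, 0) u) hg)

theorem integrable_boundaryFlux {α : Type*} [MeasurableSpace α] {ρ : Measure α}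
    [IsFiniteMeasure ρ] {g : α → State n} (hg : Integrable g ρ) (f : Fin d → State n → State n)
    (ν : SpaceTime d) (u : State n) : Integrable (fun z => boundaryFlux f ν u (g z)) ρ :=
  (integrable_const _).add ((Pminus f ν u).integrable_comp hg)

end Integrability

/-! ### Integrals of functions of the discrete solution and of its trace -/

section Grid

variable {d n : ℕ} {Ω : Polyhedron d} {T : ℝ} {ι : Type*} [Fintype ι] {M : Mesh Ω ι}
  {τ : TimeGrid T} {V : ι → ℕ → State n} {Up : SpaceTime d → State n}
  {E : Type*} [NormedAddCommGroup E]

theorem ae_gridFunction_eq (M : Mesh Ω ι) (τ : TimeGrid T) (V : ι → ℕ → State n) (i : ι) {m : ℕ}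
    (hm : m < τ.N) :
    ∀ᵐ z ∂(volume.restrict ((M.cell i).carrier ×ˢ Ioo (τ.t m) (τ.t (m + 1)))),
      gridFunction M τ V z = V i (m + 1) := by
  filter_upwards [ae_restrict_mem ((M.cell i).isOpen.prod isOpen_Ioo).measurableSet] with z hz
  exact gridFunction_eq M τ V hm hz.1 hz.2

theorem integrable_comp_gridFunction (M : Mesh Ω ι) (τ : TimeGrid T) (V : ι → ℕ → State n)
    (G : State n → E) : Integrable (fun z => G (gridFunction M τ V z)) (Ω.interiorMeasure T) := by
  simp_rw [interiorMeasure_eq_sum M τ, integrable_finsetSum_measure]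
  intro i _ m hm
  have := isFiniteMeasure_boxMeasure (M.cell i) (τ.t m) (τ.t (m + 1))
  refine (integrable_const (G (V i (m + 1)))).congr ?_
  filter_upwards [ae_gridFunction_eq M τ V i (Finset.mem_range.1 hm)] with z hz
  rw [hz]

theorem integral_gridFunction [NormedSpace ℝ E] {K : State n → SpaceTime d → E}
    (hK : Integrable (fun z => K (gridFunction M τ V z) z) (Ω.interiorMeasure T)) :
    ∫ z, K (gridFunction M τ V z) z ∂(Ω.interiorMeasure T) = ∑ i, ∑ m ∈ Finset.range τ.N,
      ∫ z in (M.cell i).carrier ×ˢ Ioo (τ.t m) (τ.t (m + 1)), K (V i (m + 1)) z := by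
  simp_rw [interiorMeasure_eq_sum M τ, integrable_finsetSum_measure] at hK ⊢
  rw [integral_finsetSum_measure fun i hi => integrable_finsetSum_measure.2 (hK i hi)]
  refine Finset.sum_congr rfl fun i hi => ?_
  rw [integral_finsetSum_measure (hK i hi)]
  refine Finset.sum_congr rfl fun m hm => integral_congr_ae ?_
  filter_upwards [ae_gridFunction_eq M τ V i (Finset.mem_range.1 hm)] with z hz
  rw [hz]

/-- A function of the boundary normal and of the trace of the discrete solution is integrable on
`Γ_T` if, on every boundary face, the function that belongs to the cell value is. -/
theorem integrable_trace (hT : 0 < T) (hUp : IsInteriorTrace Ω T (gridFunction M τ V) Up)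
    {K : SpaceTime d → State n → SpaceTime d → E}
    (hlat : ∀ i, ∀ m < τ.N, Integrable
      (fun z => K ((M.cell i).normal z.1, 0) (V i (m + 1)) z)
      (lateralMeasure τ m (frontier (M.cell i).carrier ∩ frontier Ω.carrier)))
    (hbot : ∀ i, Integrable (K (0, -1) (V i 1)) (sliceMeasure (M.cell i).carrier 0))
    (htop : ∀ i, Integrable (K (0, 1) (V i τ.N)) (sliceMeasure (M.cell i).carrier T)) :
    Integrable (fun z => K (Ω.stNormal T z) (Up z) z) (Ω.boundaryMeasure T) := by
  simp_rw [boundaryMeasure_eq_sum M τ, integrable_add_measure, integrable_finsetSum_measure]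
  refine ⟨⟨fun i _ m hm => (hlat i m (Finset.mem_range.1 hm)).congr ?_,
    fun i _ => (hbot i).congr ?_⟩, fun i _ => (htop i).congr ?_⟩
  · filter_upwards [ae_trace_lateral hUp i (Finset.mem_range.1 hm)] with z hz
    rw [hz.1, hz.2]
  · filter_upwards [ae_trace_bottom hT hUp i] with z hz
    rw [hz.1, hz.2]
  · filter_upwards [ae_trace_top hT hUp i] with z hz
    rw [hz.1, hz.2]

theorem integral_trace [NormedSpace ℝ E] (hT : 0 < T)
    (hUp : IsInteriorTrace Ω T (gridFunction M τ V) Up)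
    {K : SpaceTime d → State n → SpaceTime d → E}
    (hK : Integrable (fun z => K (Ω.stNormal T z) (Up z) z) (Ω.boundaryMeasure T)) :
    ∫ z, K (Ω.stNormal T z) (Up z) z ∂(Ω.boundaryMeasure T) =
      (∑ i, ∑ m ∈ Finset.range τ.N, ∫ z, K ((M.cell i).normal z.1, 0) (V i (m + 1)) z
        ∂(lateralMeasure τ m (frontier (M.cell i).carrier ∩ frontier Ω.carrier)))
      + (∑ i, ∫ z, K (0, -1) (V i 1) z ∂(sliceMeasure (M.cell i).carrier 0))
      + ∑ i, ∫ z, K (0, 1) (V i τ.N) z ∂(sliceMeasure (M.cell i).carrier T) := by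
  rw [boundaryMeasure_eq_sum M τ] at hK ⊢
  obtain ⟨hK12, hK3⟩ := integrable_add_measure.1 hK
  obtain ⟨hK1, hK2⟩ := integrable_add_measure.1 hK12
  rw [integral_add_measure hK12 hK3, integral_add_measure hK1 hK2]
  rw [integrable_finsetSum_measure] at hK1 hK2 hK3
  rw [integral_finsetSum_measure hK1, integral_finsetSum_measure hK2,
    integral_finsetSum_measure hK3]
  congr 1
  · congr 1
    · refine Finset.sum_congr rfl fun i hi => ?_
      rw [integral_finsetSum_measure (integrable_finsetSum_measure.1 (hK1 i hi))]
      refine Finset.sum_congr rfl fun m hm => integral_congr_ae ?_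
      filter_upwards [ae_trace_lateral hUp i (Finset.mem_range.1 hm)] with z hz
      rw [hz.1, hz.2]
    · refine Finset.sum_congr rfl fun i hi => integral_congr_ae ?_
      filter_upwards [ae_trace_bottom hT hUp i] with z hz
      rw [hz.1, hz.2]
  · refine Finset.sum_congr rfl fun i hi => integral_congr_ae ?_
    filter_upwards [ae_trace_top hT hUp i] with z hz
    rw [hz.1, hz.2]

theorem integrable_outFlux_trace (hT : 0 < T)
    (hUp : IsInteriorTrace Ω T (gridFunction M τ V) Up) (f : Fin d → State n → State n) :
    Integrable (fun z => outFlux f (Ω.stNormal T z) (Up z)) (Ω.boundaryMeasure T) := by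
  refine integrable_trace (K := fun ν u _ => outFlux f ν u) hT hUp (fun i m _ => ?_)
    (fun i => ?_) (fun i => ?_)
  · have := isFiniteMeasure_lateralMeasure τ m Ω
      (inter_subset_right (s := frontier (M.cell i).carrier))
    exact (M.cell i).integrable_comp_normal fun ν => outFlux f (ν, 0) (V i (m + 1))
  · have := isFiniteMeasure_sliceMeasure (M.cell i) 0
    exact integrable_const _
  · have := isFiniteMeasure_sliceMeasure (M.cell i) T
    exact integrable_const _

theorem integrable_Pminus_trace (hT : 0 < T)
    (hUp : IsInteriorTrace Ω T (gridFunction M τ V) Up) (f : Fin d → State n → State n)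
    {g : SpaceTime d → State n} (hg : Integrable g (Ω.boundaryMeasure T)) :
    Integrable (fun z => Pminus f (Ω.stNormal T z) (Up z) (g z)) (Ω.boundaryMeasure T) := by
  refine integrable_trace (K := fun ν u z => Pminus f ν u (g z)) hT hUp (fun i m hm => ?_)
    (fun i => ?_) (fun i => ?_)
  · exact (M.cell i).integrable_normal_apply (fun ν => Pminus f (ν, 0) (V i (m + 1)))
      (hg.mono_measure (lateralMeasure_le_boundaryMeasure τ hm inter_subset_right))
  · exact (Pminus f _ _).integrable_comp (hg.mono_measure (M.sliceMeasure_zero_le i T))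
  · exact (Pminus f _ _).integrable_comp (hg.mono_measure (M.sliceMeasure_last_le i T))

end Grid

/-! ### The semilinear form on Lipschitz functions -/

section Form

variable {d n : ℕ} {Ω : Polyhedron d} {T : ℝ} {ι : Type*}
  {D : Set (State n)} {f : Fin d → State n → State n} {g : SpaceTime d → State n}
  {F : State n → State n → Space d → State n} {V : ι → ℕ → State n} {Up : SpaceTime d → State n}

/-- A conservative flux leaves a cell through an inner face as it enters the neighbour. -/
theorem integral_lateral_flux_swap (M : Mesh Ω ι) (τ : TimeGrid T)
    (hF : IsNumericalFlux D f F) {i j : ι} (hij : i ≠ j) {u v : State n} (hu : u ∈ D) (hv : v ∈ D)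
    (m : ℕ) (φ : SpaceTime d → State n) :
    ∫ z, ⟪F v u ((M.cell j).normal z.1), φ z⟫
        ∂(lateralMeasure τ m (frontier (M.cell j).carrier ∩ frontier (M.cell i).carrier)) =
      -∫ z, ⟪F u v ((M.cell i).normal z.1), φ z⟫
        ∂(lateralMeasure τ m (frontier (M.cell i).carrier ∩ frontier (M.cell j).carrier)) := by
  rw [inter_comm (frontier (M.cell j).carrier), ← integral_neg]
  refine integral_congr_ae ?_
  filter_upwards [ae_lateralMeasure_of_ae_fst τ m (M.ae_normal_eq_neg hij)] with z hz
  rw [hz.2, hF.conservative u hu v hv _ hz.1, inner_neg_left]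

/-- Over the time steps of a cell, the fluxes through inner horizontal faces cancel. -/
theorem sum_topFlux_add_botFlux (M : Mesh Ω ι) (τ : TimeGrid T) (hT : 0 < T) (θ : ℝ) (i : ι)
    (φ : SpaceTime d → State n) :
    ∑ m ∈ Finset.range τ.N,
      ((∫ x in (M.cell i).carrier, ⟪topFlux τ θ f g V i m x, φ (x, τ.t (m + 1))⟫)
        + ∫ x in (M.cell i).carrier, ⟪botFlux θ f g V i m x, φ (x, τ.t m)⟫) =
      (∫ z, ⟪boundaryFlux f (0, -1) (V i 1) (g z), φ z⟫ ∂(sliceMeasure (M.cell i).carrier 0))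
      + ∫ z, ⟪boundaryFlux f (0, 1) (V i τ.N) (g z), φ z⟫
          ∂(sliceMeasure (M.cell i).carrier T) := by
  obtain ⟨k, hk⟩ : ∃ k, τ.N = k + 1 := Nat.exists_eq_succ_of_ne_zero (τ.pos hT).ne'
  have hlast : τ.t (k + 1) = T := hk ▸ τ.last
  have hcancel : ∀ m ∈ Finset.range k,
      (∫ x in (M.cell i).carrier, ⟪topFlux τ θ f g V i m x, φ (x, τ.t (m + 1))⟫) =
        -∫ x in (M.cell i).carrier, ⟪botFlux θ f g V i (m + 1) x, φ (x, τ.t (m + 1))⟫ := by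
    intro m hm
    have hm' : m + 1 ≠ τ.N := by have := Finset.mem_range.1 hm; omega
    simp only [topFlux, botFlux, if_neg hm', if_neg (Nat.succ_ne_zero m), inner_neg_left,
      integral_neg, neg_neg, Nat.add_sub_cancel]
  have htop : (∫ x in (M.cell i).carrier, ⟪topFlux τ θ f g V i k x, φ (x, τ.t (k + 1))⟫) =
      ∫ z, ⟪boundaryFlux f (0, 1) (V i (k + 1)) (g z), φ z⟫
        ∂(sliceMeasure (M.cell i).carrier T) := by
    rw [integral_sliceMeasure]
    simp [topFlux, hk, hlast]
  have hbot : (∫ x in (M.cell i).carrier, ⟪botFlux θ f g V i 0 x, φ (x, τ.t 0)⟫) =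
      ∫ z, ⟪boundaryFlux f (0, -1) (V i 1) (g z), φ z⟫
        ∂(sliceMeasure (M.cell i).carrier 0) := by
    rw [integral_sliceMeasure]
    simp [botFlux, τ.zero]
  rw [hk, Finset.sum_add_distrib, Finset.sum_range_succ, Finset.sum_range_succ' _ k,
    Finset.sum_congr rfl hcancel, Finset.sum_neg_distrib, htop, hbot]
  ring

theorem integrable_flux_volume {φ : SpaceTime d → State n}
    (hφ : IsTest Ω T φ) {U : SpaceTime d → State n} (hU : Integrable U (Ω.interiorMeasure T))
    (hfU : ∀ k, Integrable (fun z => f k (U z)) (Ω.interiorMeasure T)) :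
    Integrable (fun z => ⟪U z, dt φ z⟫ + ∑ k, ⟪f k (U z), dx φ z k⟫) (Ω.interiorMeasure T) :=
  (hφ.integrable_inner_fderiv hU _).add
    (integrable_finsetSum _ fun k _ => hφ.integrable_inner_fderiv (hfU k) _)

theorem integrableOn_topFlux {M : Mesh Ω ι} {τ : TimeGrid T}
    (hg : Integrable g (Ω.boundaryMeasure T)) (θ : ℝ) (i : ι) (m : ℕ) :
    IntegrableOn (topFlux τ θ f g V i m) (M.cell i).carrier := by
  have : IsFiniteMeasure ((volume : Measure (Space d)).restrict (M.cell i).carrier) :=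
    ⟨by simpa using (M.cell i).volume_carrier_lt_top⟩
  unfold topFlux
  split_ifs
  · exact integrable_boundaryFlux (integrable_sliceMeasure_iff.1
      (hg.mono_measure (M.sliceMeasure_last_le i T))) f _ _
  · exact integrable_const _

theorem integrableOn_botFlux {M : Mesh Ω ι} (hg : Integrable g (Ω.boundaryMeasure T))
    (θ : ℝ) (i : ι) (m : ℕ) : IntegrableOn (botFlux θ f g V i m) (M.cell i).carrier := by
  have : IsFiniteMeasure ((volume : Measure (Space d)).restrict (M.cell i).carrier) :=
    ⟨by simpa using (M.cell i).volume_carrier_lt_top⟩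
  unfold botFlux
  split_ifs
  · exact integrable_boundaryFlux (integrable_sliceMeasure_iff.1
      (hg.mono_measure (M.sliceMeasure_zero_le i T))) f _ _
  · exact integrable_const _

/-- Integrability on a horizontal slice against a test function. -/
theorem IsTest.integrableOn_inner_slice {φ : SpaceTime d → State n} (hφ : IsTest Ω T φ)
    (M : Mesh Ω ι) (hT : 0 < T) (i : ι) {s : ℝ} (hs : s ∈ Icc 0 T) {h : Space d → State n}
    (hh : IntegrableOn h (M.cell i).carrier) :
    IntegrableOn (fun x => ⟪h x, φ (x, s)⟫) (M.cell i).carrier :=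
  integrable_sliceMeasure_iff.1 (hφ.integrable_inner (M.ae_sliceMeasure_mem_closure i hT hs)
    (integrable_sliceMeasure_iff (G := fun z => h z.1).2 hh))

variable [Fintype ι] [DecidableEq ι]

theorem sum_sum_erase_eq_zero {a : ι → ι → ℝ} (ha : ∀ i j, i ≠ j → a j i = -a i j) :
    ∑ i, ∑ j ∈ Finset.univ.erase i, a i j = 0 := by
  have h1 : ∀ i, ∑ j ∈ Finset.univ.erase i, a i j = ∑ j, if i = j then 0 else a i j := by
    intro i
    rw [← Finset.add_sum_erase _ _ (Finset.mem_univ i), if_pos rfl, zero_add]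
    exact Finset.sum_congr rfl fun j hj => (if_neg (Finset.ne_of_mem_erase hj).symm).symm
  simp_rw [h1]
  -- Exchanging the summation indices changes the sign.
  refine self_eq_neg.1 ?_
  conv_lhs => rw [Finset.sum_comm]
  simp_rw [← Finset.sum_neg_distrib]
  refine Finset.sum_congr rfl fun i _ => Finset.sum_congr rfl fun j _ => ?_
  by_cases h : i = j
  · simp [h]
  · rw [if_neg h, if_neg (Ne.symm h), ha i j h]

/-- For a single Lipschitz test function, `N(U_h, φ)` is the defect of `U_h` in the weak form of
the boundary value problem: only boundary faces contribute. -/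
theorem semilinearForm_eq (M : Mesh Ω ι) (τ : TimeGrid T) (hT : 0 < T) (θ : ℝ)
    (hF : IsNumericalFlux D f F) (hV : ∀ i, ∀ m < τ.N, V i (m + 1) ∈ D)
    (hg : Integrable g (Ω.boundaryMeasure T))
    (hUp : IsInteriorTrace Ω T (gridFunction M τ V) Up)
    {φ : SpaceTime d → State n} (hφ : IsTest Ω T φ) :
    semilinearForm M τ θ f F g V (fun _ _ => φ) =
      ∫ z, ⟪boundaryFlux f (Ω.stNormal T z) (Up z) (g z), φ z⟫ ∂(Ω.boundaryMeasure T)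
      - ∫ z, (⟪gridFunction M τ V z, dt φ z⟫ + ∑ k, ⟪f k (gridFunction M τ V z), dx φ z k⟫)
          ∂(Ω.interiorMeasure T) := by
  have hflux : Integrable (fun z => boundaryFlux f (Ω.stNormal T z) (Up z) (g z))
      (Ω.boundaryMeasure T) :=
    (integrable_outFlux_trace hT hUp f).add (integrable_Pminus_trace hT hUp f hg)
  rw [integral_trace (K := fun ν u z => ⟪boundaryFlux f ν u (g z), φ z⟫) hT hUp
      (hφ.integrable_inner (M.ae_boundaryMeasure_mem_closure τ hT) hflux),
    integral_gridFunction (K := fun u z => ⟪u, dt φ z⟫ + ∑ k, ⟪f k u, dx φ z k⟫)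
      (integrable_flux_volume hφ (integrable_comp_gridFunction M τ V id)
        fun k => integrable_comp_gridFunction M τ V (f k))]
  have hinner : ∑ i, ∑ m ∈ Finset.range τ.N, ∑ j ∈ Finset.univ.erase i,
      ∫ z, ⟪F (V i (m + 1)) (V j (m + 1)) ((M.cell i).normal z.1), φ z⟫
        ∂(lateralMeasure τ m (frontier (M.cell i).carrier ∩ frontier (M.cell j).carrier)) = 0 := by
    rw [Finset.sum_comm]
    refine Finset.sum_eq_zero fun m hm => sum_sum_erase_eq_zero fun i j hij => ?_
    have hm := Finset.mem_range.1 hm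
    exact integral_lateral_flux_swap M τ hF hij (hV i m hm) (hV j m hm) m φ
  have htime := Finset.sum_congr (rfl : (Finset.univ : Finset ι) = Finset.univ)
    fun i _ => sum_topFlux_add_botFlux (f := f) (g := g) (V := V) M τ hT θ i φ
  simp only [Finset.sum_add_distrib] at htime
  simp only [semilinearForm, Finset.sum_sub_distrib, Finset.sum_add_distrib, hinner]
  linarith

/-- `N(U_h, ·)` is linear; the integrals converge for Lipschitz and for piecewise constant
arguments. -/
theorem semilinearForm_sub_const (M : Mesh Ω ι) (τ : TimeGrid T) (hT : 0 < T) (θ : ℝ)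
    (f : Fin d → State n → State n) (F : State n → State n → Space d → State n)
    (hg : Integrable g (Ω.boundaryMeasure T)) (V : ι → ℕ → State n)
    {φ : SpaceTime d → State n} (hφ : IsTest Ω T φ) (c : ι → ℕ → State n) :
    semilinearForm M τ θ f F g V (fun i m z => φ z - c i m) =
      semilinearForm M τ θ f F g V (fun _ _ => φ)
        - semilinearForm M τ θ f F g V (fun i m _ => c i m) := by
  have split {α : Type _} [MeasurableSpace α] {μ : Measure α} {h w : α → State n} {c : State n}
      (hh : Integrable h μ) (hw : Integrable (fun z => ⟪h z, w z⟫) μ) :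
      ∫ z, ⟪h z, w z - c⟫ ∂μ = (∫ z, ⟪h z, w z⟫ ∂μ) - ∫ z, ⟪h z, c⟫ ∂μ := by
    simp_rw [inner_sub_right]
    exact integral_sub hw (hh.inner_const c)
  unfold semilinearForm
  simp_rw [← Finset.sum_sub_distrib]
  refine Finset.sum_congr rfl fun i _ => Finset.sum_congr rfl fun m hm => ?_
  have hm : m < τ.N := Finset.mem_range.1 hm
  have hlat (j : ι) : IsFiniteMeasure (lateralMeasure τ m
      (frontier (M.cell i).carrier ∩ frontier (M.cell j).carrier)) :=
    isFiniteMeasure_lateralMeasure τ m (M.cell i) inter_subset_left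
  have hbdry : IsFiniteMeasure (lateralMeasure τ m
      (frontier (M.cell i).carrier ∩ frontier Ω.carrier)) :=
    isFiniteMeasure_lateralMeasure τ m (M.cell i) inter_subset_left
  have hmem (P : Polyhedron d) : ∀ᵐ z ∂(lateralMeasure τ m
      (frontier (M.cell i).carrier ∩ frontier P.carrier)), z ∈ closure (Ω.cylinder T) :=
    ae_lateralMeasure_mem_closure τ hm (M.measurableSet_inter i P)
      (inter_subset_left.trans (M.frontier_cell_subset i))
  have h1 (j : ι) := (M.cell i).integrable_comp_normal (μ := lateralMeasure τ m
      (frontier (M.cell i).carrier ∩ frontier (M.cell j).carrier))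
      (F (V i (m + 1)) (V j (m + 1)))
  have h2 := integrable_boundaryFlux_normal (M.cell i) (hg.mono_measure
    (lateralMeasure_le_boundaryMeasure τ hm
      (inter_subset_right (s := frontier (M.cell i).carrier)))) f (V i (m + 1))
  have h3 := integrableOn_topFlux (f := f) (V := V) (M := M) (τ := τ) hg θ i m
  have h4 := integrableOn_botFlux (f := f) (V := V) (M := M) hg θ i m
  rw [Finset.sum_congr rfl fun j _ => split (h1 j) (hφ.integrable_inner (hmem _) (h1 j)),
    split h2 (hφ.integrable_inner (hmem Ω) h2),
    split h3 (hφ.integrableOn_inner_slice M hT i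
      ⟨τ.nonneg (m := m + 1) hm, τ.le_last (m := m + 1) hm⟩ h3),
    split h4 (hφ.integrableOn_inner_slice M hT i ⟨τ.nonneg hm.le, τ.le_last hm.le⟩ h4),
    Finset.sum_sub_distrib]
  simp only [dt, dx, fderiv_sub_const, fderiv_fun_const, Pi.zero_apply, zero_apply,
    inner_zero_right, Finset.sum_const_zero, add_zero, integral_zero]
  ring

end Form

end AdjointError

theorem theorem1 {d n : ℕ} (hd : 1 ≤ d) {ι : Type*} [Fintype ι] [DecidableEq ι]
    (Ω : Polyhedron d) (T : ℝ) (hT : 0 < T)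
    (D : Set (State n)) (f : Fin d → State n → State n) (hf : IsHyperbolic D f)
    (g : SpaceTime d → State n) (hg : Integrable g (Ω.boundaryMeasure T))
    (U Up : SpaceTime d → State n) (hU : IsWeakSolution Ω T D f g U Up)
    (M : Mesh Ω ι) (τ : TimeGrid T) (θ : ℝ) (hθ : θ ∈ Set.Icc (0 : ℝ) 1)
    (F : State n → State n → Space d → State n) (hF : IsNumericalFlux D f F)
    (V : ι → ℕ → State n) (hV : IsDG0Solution M τ θ D f F g V)
    (Uh Uhp : SpaceTime d → State n) (hUh : Uh = gridFunction M τ V)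
    (hUhp : IsInteriorTrace Ω T Uh Uhp)
    (ψ ψΓ : SpaceTime d → State n)
    (hJ : TargetDefined Ω T f ψ ψΓ U Up) (hJh : TargetDefined Ω T f ψ ψΓ Uh Uhp)
    (φ : SpaceTime d → State n) (hφ : IsAdjointSolution Ω T f ψ ψΓ Uh Uhp φ) :
    (target Ω T f ψ ψΓ U Up - target Ω T f ψ ψΓ Uh Uhp)
        + inflowError Ω T f g Up Uhp φ + outflowError Ω T f ψΓ Up Uhp φ
        + linearizationError Ω T f U Uh φ
      = semilinearForm M τ θ f F g V (fun _ _ => φ) ∧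
    ∀ φh : ι → ℕ → State n,
      semilinearForm M τ θ f F g V (fun _ _ => φ)
        = semilinearForm M τ θ f F g V (fun i m z => φ z - φh i m) := by
  subst hUh
  have hUhi : Integrable (gridFunction M τ V) (Ω.interiorMeasure T) :=
    integrable_comp_gridFunction M τ V id
  have hfUh := fun k => integrable_comp_gridFunction M τ V (f k)
  have hout := integrable_outFlux_trace hT hUhp f
  have hin := integrable_Pminus_trace hT hUhp f hg
  have hcl := M.ae_boundaryMeasure_mem_closure τ hT
  have hφt := hφ.test
  have hform := semilinearForm_eq M τ hT θ hF hV.mem hg hUhp hφt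
  refine ⟨?_, fun φh => ?_⟩
  · have hweak := hU.weak φ hφt
    have htest {h : SpaceTime d → State n} (hh : Integrable h (Ω.boundaryMeasure T)) :=
      hφt.integrable_inner hcl hh
    have hvol := integrable_flux_volume hφt hU.integrable hU.integrable_flux
    have hvolh := integrable_flux_volume hφt hUhi hfUh
    -- Added to `(U - U_h, φ_t)`, the linear part of the flux difference is `(U - U_h, ψ)` by the
    -- adjoint equation.
    have hlin : linearizationError Ω T f U (gridFunction M τ V) φ =
        ((∫ z, (⟪U z, dt φ z⟫ + ∑ k, ⟪f k (U z), dx φ z k⟫) ∂(Ω.interiorMeasure T))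
          - ∫ z, (⟪gridFunction M τ V z, dt φ z⟫
            + ∑ k, ⟪f k (gridFunction M τ V z), dx φ z k⟫) ∂(Ω.interiorMeasure T))
        - ((∫ z, ⟪U z, ψ z⟫ ∂(Ω.interiorMeasure T))
          - ∫ z, ⟪gridFunction M τ V z, ψ z⟫ ∂(Ω.interiorMeasure T)) := by
      refine Eq.trans (integral_congr_ae ?_)
        ((integral_sub (hvol.sub hvolh) (hJ.1.sub hJh.1)).trans
          (congrArg₂ (· - ·) (integral_sub hvol hvolh) (integral_sub hJ.1 hJh.1)))
      filter_upwards [hφ.interior] with z hz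
      simp only [Pi.sub_apply, ← hz, inner_add_right, inner_sum,
        ContinuousLinearMap.adjoint_inner_right, inner_sub_left, map_sub, Finset.sum_sub_distrib]
      ring
    have hboundary : ∫ z, ⟪boundaryFlux f (Ω.stNormal T z) (Uhp z) (g z), φ z⟫
          ∂(Ω.boundaryMeasure T) =
        (∫ z, ⟪outFlux f (Ω.stNormal T z) (Uhp z), φ z⟫ ∂(Ω.boundaryMeasure T))
        + ∫ z, ⟪Pminus f (Ω.stNormal T z) (Uhp z) (g z), φ z⟫ ∂(Ω.boundaryMeasure T) := by
      simp_rw [boundaryFlux, inner_add_left]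
      exact integral_add (htest hout) (htest hin)
    have hinflow : inflowError Ω T f g Up Uhp φ =
        -((∫ z, ⟪Pminus f (Ω.stNormal T z) (Up z) (g z), φ z⟫ ∂(Ω.boundaryMeasure T))
          - ∫ z, ⟪Pminus f (Ω.stNormal T z) (Uhp z) (g z), φ z⟫ ∂(Ω.boundaryMeasure T)) := by
      simp_rw [inflowError, sub_apply, inner_sub_left]
      rw [integral_sub (htest hU.integrable_in) (htest hin)]
    have houtflow : outflowError Ω T f ψΓ Up Uhp φ =
        -(((∫ z, ⟪outFlux f (Ω.stNormal T z) (Up z), φ z⟫ ∂(Ω.boundaryMeasure T))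
            - ∫ z, ⟪outFlux f (Ω.stNormal T z) (Uhp z), φ z⟫ ∂(Ω.boundaryMeasure T))
          - ((∫ z, ⟪outFlux f (Ω.stNormal T z) (Up z), ψΓ z⟫ ∂(Ω.boundaryMeasure T))
            - ∫ z, ⟪outFlux f (Ω.stNormal T z) (Uhp z), ψΓ z⟫ ∂(Ω.boundaryMeasure T))) := by
      have h1 := htest hU.integrable_out
      have h2 := htest hout
      refine congrArg Neg.neg (Eq.trans (integral_congr_ae (ae_of_all _ fun z => ?_))
        ((integral_sub (h1.sub h2) (hJ.2.sub hJh.2)).trans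
          (congrArg₂ (· - ·) (integral_sub h1 h2) (integral_sub hJ.2 hJh.2))))
      simp only [Pi.sub_apply, inner_sub_left, inner_sub_right]
    rw [hform, hboundary, hlin, hinflow, houtflow, target, target]
    linarith
  · rw [semilinearForm_sub_const M τ hT θ f F hg V hφt φh, hV.galerkin φh, sub_zero]
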